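/- For a positive integer $k$ let $\Omega(k)$ denote the total number of prime divisors of $k$, counted with multiplicity, and for integers $n\geq 2$ put $$\mathcal{A}_1(n)=\frac{1}{n}\sum_{k=1}^{n}\Omega(k)-\log\log n ,$$ where $\log$ is the natural logarithm. Let $\alpha_1=\frac{8}{7}-\log\log 7$. Then for every integer $n\geq 2$, $$\alpha_1\leq \mathcal{A}_1(n).$$ The constant $\alpha_1$ is best possible, that is, it is the largest real number $c$ such that $c\leq\mathcal{A}_1(n)$ for all integers $n\geq 2$; and, for an integer $n\geq 2$, equality $\mathcal{A}_1(n)=\alpha_1$ holds if and only if $n=7$. -/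

import Mathlib

/-- `omegaAverageDiff n` is the difference between the average of `Ω(k)` over `1 ≤ k ≤ n`, where
`Ω(k)` is the total number of prime divisors of `k` counted with multiplicity, and
`log log n` (natural logarithms). It is meaningful for `n ≥ 2`. -/
noncomputable def omegaAverageDiff (n : ℕ) : ℝ :=
  (1 / (n : ℝ)) * ∑ k ∈ Finset.Icc 1 n, (ArithmeticFunction.cardFactors k : ℝ)
    - Real.log (Real.log (n : ℝ))

/-!
Counting pairs `(k, q)` with `q` a prime power dividing `k ≤ n` gives
`∑_{k ≤ n} Ω(k) = ∑_{q ≤ n} ⌊n / q⌋`, the right-hand sum being over prime powers. So the average of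
`Ω` is roughly `∑_{q ≤ n} 1 / q`, which exceeds `log log n` by about `1.03`, whereas the claimed
bound only asks for an excess of `0.477`. This slack leaves room for an elementary argument.

For large `n` the input is Legendre's identity `log n! = ∑_{q ≤ n} Λ(q) ⌊n / q⌋`. Comparing it for
`k` and for `n` yields a Mertens type bound
`T k = ∑_{q ≤ k} Λ(q) ⌊n / q⌋ ≥ (n / k - 1) log k!` (`le_sum_vonMangoldt_mul_div`). Since
`Λ(q) / log q ≤ 1`, summation by parts against `1 / log q` turns it into a lower bound for
`∑_{m < q ≤ n} ⌊n / q⌋` (`le_sum_vonMangoldt_div_log`): Stirling's lower bound for `log k!` makes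
the `k`-th step of the summation at least `n` times the increment of the primitive
`log log x + 1 / log x` of `(log x - 1) / (x log² x)`, up to an error `1 / log k`
(`primitive_sub_le`, `partialSum_step`). Starting at `m = 49` and treating the prime powers up to
`49` individually (`le_sum_small`), everything is explicit enough to conclude for all `n ≥ 50`.

For `n < 50` it is enough to compare powers of `n` and of `7`: if `n ^ u < 7 ^ v` then
`log log n - log log 7 < log (v / u)`, and `(1 + x / 2) ^ 2 ≤ exp x` reduces the claim to a
comparison of integers (`log_log_sub_lt`).
-/

open Finset ArithmeticFunction

/-! ### Sums over prime powers -/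

/-- The indicator function of the prime powers, as an arithmetic function. -/
noncomputable def primePowIndicator : ArithmeticFunction ℕ :=
  ⟨fun n => open Classical in if IsPrimePow n then 1 else 0, by simp [not_isPrimePow_zero]⟩

theorem primePowIndicator_of_isPrimePow {n : ℕ} (h : IsPrimePow n) : primePowIndicator n = 1 :=
  if_pos h

theorem primePowIndicator_of_not {n : ℕ} (h : ¬ IsPrimePow n) : primePowIndicator n = 0 :=
  if_neg h

theorem sum_divisors_primePowIndicator {n : ℕ} (hn : n ≠ 0) :
    ∑ d ∈ n.divisors, primePowIndicator d = cardFactors n := by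
  classical
  induction n using Nat.recOnPrimeCoprime with
  | zero => exact absurd rfl hn
  | prime_pow p k hp =>
    rw [Nat.sum_divisors_prime_pow hp, cardFactors_apply_prime_pow hp, sum_range_succ',
      pow_zero, primePowIndicator_of_not not_isPrimePow_one, add_zero,
      sum_congr rfl fun i _ =>
        primePowIndicator_of_isPrimePow (hp.isPrimePow.pow (Nat.succ_ne_zero i))]
    simp
  | coprime a b ha hb hab iha ihb =>
    have iha := iha (by lia)
    have ihb := ihb (by lia)
    have key (m : ℕ) : ∑ d ∈ m.divisors, primePowIndicator d
        = ∑ d ∈ m.divisors with IsPrimePow d, 1 := by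
      rw [sum_filter]
      exact sum_congr rfl fun d _ => by simp [primePowIndicator]
    rw [key] at iha ihb ⊢
    rw [Nat.mul_divisors_filter_prime_pow hab, filter_union,
      sum_union (Nat.disjoint_divisors_filter_isPrimePow hab), iha, ihb,
      cardFactors_mul (by lia) (by lia)]

theorem sum_cardFactors_eq (n : ℕ) :
    ∑ k ∈ Icc 1 n, cardFactors k = ∑ q ∈ Ioc 0 n, primePowIndicator q * (n / q) := by
  have h := sum_Ioc_mul_zeta_eq_sum primePowIndicator n
  simp only [Nat.cast_id] at h
  rw [← h, show Icc 1 n = Ioc 0 n from rfl]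
  refine sum_congr rfl fun k hk => ?_
  rw [coe_mul_zeta_apply, sum_divisors_primePowIndicator (by simp at hk; lia)]

/-- Legendre's identity. -/
theorem log_factorial_eq_sum_vonMangoldt (n : ℕ) :
    Real.log n.factorial = ∑ q ∈ Ioc 0 n, vonMangoldt q * ((n / q : ℕ) : ℝ) := by
  rw [← sum_Ioc_mul_zeta_eq_sum vonMangoldt n, vonMangoldt_mul_zeta]
  induction n with
  | zero => simp
  | succ n ih =>
    rw [sum_Ioc_succ_top (Nat.zero_le n), ← ih, Nat.factorial_succ, Nat.cast_mul,
      Real.log_mul (by positivity) (by positivity), add_comm, log_apply]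

theorem vonMangoldt_le_log_mul_primePowIndicator (q : ℕ) :
    vonMangoldt q ≤ Real.log q * primePowIndicator q := by
  by_cases h : IsPrimePow q
  · simpa [primePowIndicator_of_isPrimePow h] using vonMangoldt_le_log (n := q)
  · simp [primePowIndicator_of_not h, vonMangoldt_eq_zero_iff.2 h]

/-! ### A Mertens type bound and summation by parts -/

theorem le_sum_vonMangoldt_mul_div {n k : ℕ} (hk : 0 < k) (hkn : k ≤ n) :
    ((n : ℝ) / k - 1) * Real.log k.factorial
      ≤ ∑ q ∈ Ioc 0 k, vonMangoldt q * ((n / q : ℕ) : ℝ) := by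
  rw [log_factorial_eq_sum_vonMangoldt, mul_sum]
  refine sum_le_sum fun q hq => ?_
  rw [mul_left_comm]
  refine mul_le_mul_of_nonneg_left ?_ vonMangoldt_nonneg
  obtain ⟨hq0, hqk⟩ := mem_Ioc.1 hq
  have hk' : (0 : ℝ) < k := by exact_mod_cast hk
  have hq' : (0 : ℝ) < q := by exact_mod_cast hq0
  have hkn' : (k : ℝ) ≤ n := by exact_mod_cast hkn
  have hqk' : (q : ℝ) ≤ k := by exact_mod_cast hqk
  have h1 : ((k / q : ℕ) : ℝ) ≤ k / q := Nat.cast_div_le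
  have h2 : (n : ℝ) / q - 1 ≤ ((n / q : ℕ) : ℝ) := by
    have : (n : ℝ) / q < ((n / q : ℕ) : ℝ) + 1 := by
      rw [← Nat.floor_div_eq_div (K := ℝ)]
      exact Nat.lt_floor_add_one _
    linarith
  have h3 : 0 ≤ (n : ℝ) / k - 1 := by
    rw [sub_nonneg, le_div_iff₀ hk']
    linarith
  calc ((n : ℝ) / k - 1) * ((k / q : ℕ) : ℝ) ≤ ((n : ℝ) / k - 1) * (k / q) := by gcongr
    _ = n / q - k / q := by field_simp
    _ ≤ n / q - 1 := by
      have : 1 ≤ (k : ℝ) / q := by rwa [le_div_iff₀ hq', one_mul]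
      linarith
    _ ≤ _ := h2

theorem log_le_half_sub_inv {x : ℝ} (hx : 1 ≤ x) : Real.log x ≤ (x - x⁻¹) / 2 := by
  rw [← Real.sinh_log (by linarith)]
  exact Real.self_le_sinh_iff.2 (Real.log_nonneg hx)

theorem mul_log_sub_add_half_log_le_log_factorial {k : ℕ} (hk : k ≠ 0) :
    k * Real.log k - k + Real.log k / 2 ≤ Real.log k.factorial := by
  have h := Stirling.le_log_factorial_stirling hk
  have : 0 ≤ Real.log (2 * Real.pi) := Real.log_nonneg (by linarith [Real.pi_gt_three])
  linarith

theorem one_le_log_of_three_le {k : ℕ} (hk : 3 ≤ k) : 1 ≤ Real.log k := by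
  have hk' : (3 : ℝ) ≤ k := by exact_mod_cast hk
  rw [Real.le_log_iff_exp_le (by linarith)]
  linarith [Real.exp_one_lt_three]

theorem log_succ_sub_log_le {k : ℕ} (hk : 0 < k) :
    Real.log (k + 1) - Real.log k ≤ 1 / k := by
  have hk' : (0 : ℝ) < k := by exact_mod_cast hk
  rw [← Real.log_div (by positivity) (by positivity)]
  have := Real.log_le_sub_one_of_pos (x := ((k : ℝ) + 1) / k) (by positivity)
  have e : ((k : ℝ) + 1) / k - 1 = 1 / k := by field_simp; ring
  linarith

/-- A primitive of `(log x - 1) / (x log² x)`. -/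
noncomputable def primitive (x : ℝ) : ℝ := Real.log (Real.log x) + 1 / Real.log x

theorem primitive_sub_le {k : ℕ} (hk : 3 ≤ k) :
    primitive (k + 1) - primitive k
      ≤ Real.log k.factorial / k * (1 / Real.log k - 1 / Real.log (k + 1)) := by
  have hk0 : (0 : ℝ) < k := by exact_mod_cast (by lia : 0 < k)
  have hL := one_le_log_of_three_le hk
  have hd := log_succ_sub_log_le (k := k) (by lia)
  have hLL : Real.log k ≤ Real.log (k + 1) := Real.log_le_log hk0 (by linarith)
  have hS := mul_log_sub_add_half_log_le_log_factorial (k := k) (by lia)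
  unfold primitive
  set L := Real.log k
  set L' := Real.log (k + 1)
  set D := 1 / L - 1 / L' with hD
  have hL0 : 0 < L := by linarith
  have hL'0 : 0 < L' := by linarith
  have hD0 : 0 ≤ D := by
    rw [hD, sub_nonneg]
    gcongr
  have h1 : L - 1 + L / (2 * k) ≤ Real.log k.factorial / k := by
    rw [le_div_iff₀ hk0]
    refine le_trans (le_of_eq ?_) hS
    field_simp
  have h2 : Real.log L' - Real.log L ≤ (L' / L - (L' / L)⁻¹) / 2 := by
    rw [← Real.log_div hL'0.ne' hL0.ne']
    exact log_le_half_sub_inv (by rwa [le_div_iff₀ hL0, one_mul])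
  -- The half-logarithm in Stirling's formula pays for the second order term of `log (L' / L)`.
  have h3 : (L' / L - (L' / L)⁻¹) / 2 ≤ L * D * (1 + 1 / (2 * k)) := by
    have e1 : (L' / L - (L' / L)⁻¹) / 2 = L * D * ((L' / L + 1) / 2) := by
      rw [hD]
      field_simp
      ring
    have e2 : (L' / L + 1) / 2 ≤ 1 + 1 / (2 * k) := by
      have : L' / L - 1 ≤ 1 / k := by
        rw [div_sub_one hL0.ne', div_le_iff₀ hL0]
        have : 1 / (k : ℝ) * 1 ≤ 1 / k * L := by gcongr
        linarith
      have e3 : 1 / (2 * (k : ℝ)) = 1 / k / 2 := by field_simp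
      linarith
    rw [e1]
    gcongr
  have h4 : (L - 1 + L / (2 * k)) * D ≤ Real.log k.factorial / k * D := by gcongr
  have h5 : (L - 1 + L / (2 * k)) * D = L * D * (1 + 1 / (2 * k)) - D := by ring
  linarith

theorem log_factorial_mul_le {k : ℕ} (hk : 3 ≤ k) :
    Real.log k.factorial * (1 / Real.log k - 1 / Real.log (k + 1)) ≤ 1 / Real.log k := by
  have hk0 : (0 : ℝ) < k := by exact_mod_cast (by lia : 0 < k)
  have hL := one_le_log_of_three_le hk
  have hd := log_succ_sub_log_le (k := k) (by lia)
  have hLL : Real.log k ≤ Real.log (k + 1) := Real.log_le_log hk0 (by linarith)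
  have hF : Real.log k.factorial ≤ k * Real.log k := by
    rw [← Real.log_pow]
    exact Real.log_le_log (by positivity) (by exact_mod_cast Nat.factorial_le_pow k)
  set L := Real.log k
  set L' := Real.log (k + 1)
  have hL0 : 0 < L := by linarith
  have hL'0 : 0 < L' := by linarith
  have e : 1 / L - 1 / L' = (L' - L) / (L * L') := by field_simp
  have h0 : 0 ≤ 1 / L - 1 / L' := by
    rw [sub_nonneg]
    gcongr
  calc Real.log k.factorial * (1 / L - 1 / L') ≤ k * L * (1 / L - 1 / L') := by gcongr
    _ ≤ k * L * (1 / k / (L * L')) := by rw [e]; gcongr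
    _ = 1 / L' := by field_simp
    _ ≤ 1 / L := by gcongr

/-- One step of the summation by parts: the loss `1 / log k` comes from rounding `n / q` down. -/
theorem partialSum_step {n k : ℕ} (hk : 3 ≤ k) (hkn : k ≤ n) :
    n * (primitive (k + 1) - primitive k) - 1 / Real.log k
      ≤ (∑ q ∈ Ioc 0 k, vonMangoldt q * ((n / q : ℕ) : ℝ))
        * (1 / Real.log k - 1 / Real.log (k + 1)) := by
  have hk0 : (0 : ℝ) < k := by exact_mod_cast (by lia : 0 < k)
  have hL := one_le_log_of_three_le hk
  have hLL : Real.log k ≤ Real.log (k + 1) := Real.log_le_log hk0 (by linarith)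
  have h0 : 0 ≤ 1 / Real.log k - 1 / Real.log (k + 1) := by
    rw [sub_nonneg]
    gcongr
  have h1 := mul_le_mul_of_nonneg_right (le_sum_vonMangoldt_mul_div (by lia) hkn) h0
  have h2 := mul_le_mul_of_nonneg_left (primitive_sub_le hk) (Nat.cast_nonneg (α := ℝ) n)
  have h3 := log_factorial_mul_le hk
  have e : ((n : ℝ) / k - 1) * Real.log k.factorial * (1 / Real.log k - 1 / Real.log (k + 1))
      = n * (Real.log k.factorial / k * (1 / Real.log k - 1 / Real.log (k + 1)))
        - Real.log k.factorial * (1 / Real.log k - 1 / Real.log (k + 1)) := by ring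
  linarith

/-- Summation by parts of `Λ(q) ⌊n / q⌋` against `1 / log q`, with each `1 / log k` in the error
term estimated by `1 / log (m + 1)`. -/
theorem le_sum_vonMangoldt_div_log {n m K : ℕ} (hm : 2 ≤ m) (hmK : m + 1 ≤ K) (hKn : K ≤ n) :
    (∑ q ∈ Ioc 0 K, vonMangoldt q * ((n / q : ℕ) : ℝ)) / Real.log K
        - (∑ q ∈ Ioc 0 m, vonMangoldt q * ((n / q : ℕ) : ℝ)) / Real.log (m + 1)
        + n * (primitive K - primitive (m + 1)) - ((K : ℝ) - (m + 1)) / Real.log (m + 1)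
      ≤ ∑ q ∈ Ioc m K, vonMangoldt q * ((n / q : ℕ) : ℝ) / Real.log q := by
  induction K, hmK using Nat.le_induction with
  | base =>
    rw [sum_Ioc_succ_top (Nat.zero_le m), sum_Ioc_succ_top le_rfl, Ioc_self, sum_empty]
    push_cast
    apply le_of_eq
    ring
  | succ k hk ih =>
    have ih := ih (by lia)
    have hs := partialSum_step (n := n) (k := k) (by lia) (by lia)
    have hl : 1 / Real.log k ≤ 1 / Real.log (m + 1) := by
      have h1 : 1 ≤ Real.log ((m + 1 : ℕ) : ℝ) := one_le_log_of_three_le (by lia)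
      push_cast at h1
      have : (m : ℝ) + 1 ≤ k := by exact_mod_cast hk
      gcongr
    rw [sum_Ioc_succ_top (Nat.zero_le k), sum_Ioc_succ_top (by lia : m ≤ k)]
    push_cast
    have e : ((k : ℝ) + 1 - (m + 1)) / Real.log (m + 1)
        = ((k : ℝ) - (m + 1)) / Real.log (m + 1) + 1 / Real.log (m + 1) := by ring
    rw [e, add_div]
    rw [mul_sub (∑ q ∈ Ioc 0 k, _), mul_one_div, mul_one_div] at hs
    linarith

/-! ### Prime powers below fifty -/

/-- The prime powers below `50`. -/
def smallPrimePows : Finset ℕ :=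
  {2, 3, 4, 5, 7, 8, 9, 11, 13, 16, 17, 19, 23, 25, 27, 29, 31, 32, 37, 41, 43, 47, 49}

theorem isPrimePow_of_mem_smallPrimePows {q : ℕ} (hq : q ∈ smallPrimePows) : IsPrimePow q := by
  have key (p k : ℕ) (hp : p.Prime) (hk : k ≠ 0) : IsPrimePow (p ^ k) := hp.isPrimePow.pow hk
  simp only [smallPrimePows, mem_insert, mem_singleton] at hq
  rcases hq with rfl | rfl | rfl | rfl | rfl | rfl | rfl | rfl | rfl | rfl | rfl | rfl | rfl | rfl |
    rfl | rfl | rfl | rfl | rfl | rfl | rfl | rfl | rfl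
  all_goals first
    | exact key 2 2 (by norm_num) (by norm_num)
    | exact key 2 3 (by norm_num) (by norm_num)
    | exact key 2 4 (by norm_num) (by norm_num)
    | exact key 2 5 (by norm_num) (by norm_num)
    | exact key 3 2 (by norm_num) (by norm_num)
    | exact key 3 3 (by norm_num) (by norm_num)
    | exact key 5 2 (by norm_num) (by norm_num)
    | exact key 7 2 (by norm_num) (by norm_num)
    | exact Nat.Prime.isPrimePow (by norm_num)

theorem sum_smallPrimePows_le (n : ℕ) :
    ∑ q ∈ smallPrimePows, n / q ≤ ∑ k ∈ Icc 1 n, cardFactors k := by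
  rw [sum_cardFactors_eq]
  calc ∑ q ∈ smallPrimePows, n / q
      = ∑ q ∈ smallPrimePows with q ∈ Ioc 0 n, n / q := by
        refine (sum_filter_of_ne fun q hq h => ?_).symm
        rw [Ne, Nat.div_eq_zero_iff, not_or] at h
        exact mem_Ioc.2 ⟨by lia, by lia⟩
    _ = ∑ q ∈ smallPrimePows with q ∈ Ioc 0 n, primePowIndicator q * (n / q) := by
        refine sum_congr rfl fun q hq => ?_
        rw [primePowIndicator_of_isPrimePow
          (isPrimePow_of_mem_smallPrimePows (mem_filter.1 hq).1), one_mul]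
    _ ≤ _ := sum_le_sum_of_subset fun q hq => (mem_filter.1 hq).2

/-- A prime power `p ^ k` contributes at least the main term of `⌊n / p ^ k⌋`, weighted by a lower
bound for `1 - Λ(p ^ k) / log 50`, which comes from a comparison of powers of `p` and of `50`. -/
theorem le_weight_mul_div (n p k a b : ℕ) (hp : p.Prime) (hk : k ≠ 0) (ha : 0 < a) (hba : b ≤ a)
    (h : p ^ a ≤ 50 ^ b) :
    ((n : ℝ) / (p ^ k : ℕ) - 1) * (1 - (b : ℝ) / a)
      ≤ (primePowIndicator (p ^ k) - vonMangoldt (p ^ k) / Real.log 50)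
        * ((n / p ^ k : ℕ) : ℝ) := by
  rw [primePowIndicator_of_isPrimePow (hp.isPrimePow.pow hk), vonMangoldt_apply_pow hk,
    vonMangoldt_apply_prime hp, Nat.cast_one]
  have hL : 0 < Real.log 50 := Real.log_pos (by norm_num)
  have ha' : (0 : ℝ) < a := by exact_mod_cast ha
  have h1 : Real.log p / Real.log 50 ≤ b / a := by
    rw [div_le_div_iff₀ hL ha', mul_comm, ← Real.log_pow, ← Real.log_pow]
    exact Real.log_le_log (by have := hp.pos; positivity) (by exact_mod_cast h)
  have h2 : (n : ℝ) / (p ^ k : ℕ) - 1 ≤ ((n / p ^ k : ℕ) : ℝ) := by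
    have : (n : ℝ) / (p ^ k : ℕ) < ((n / p ^ k : ℕ) : ℝ) + 1 := by
      rw [← Nat.floor_div_eq_div (K := ℝ)]
      exact Nat.lt_floor_add_one _
    linarith
  have h3 : (b : ℝ) / a ≤ 1 := by
    rw [div_le_one ha']
    exact_mod_cast hba
  calc ((n : ℝ) / (p ^ k : ℕ) - 1) * (1 - (b : ℝ) / a)
      ≤ ((n / p ^ k : ℕ) : ℝ) * (1 - (b : ℝ) / a) :=
        mul_le_mul_of_nonneg_right h2 (by linarith)
    _ ≤ ((n / p ^ k : ℕ) : ℝ) * (1 - Real.log p / Real.log 50) := by gcongr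
    _ = _ := mul_comm _ _

/-- The constants are `∑ (1 - c_q) / q` and `∑ (1 - c_q)` over the prime powers `q < 50`, rounded,
where `c_q` is a rational upper bound for `Λ(q) / log 50`. Primes `p ≥ 29` have `c_p = 1` and do
not contribute. -/
theorem le_sum_small (n : ℕ) :
    1.4437 * (n : ℝ) - 9.66
      ≤ ∑ q ∈ Ioc 0 49, (primePowIndicator q - vonMangoldt q / Real.log 50)
        * ((n / q : ℕ) : ℝ) := by
  have hL : 0 < Real.log 50 := Real.log_pos (by norm_num)
  have hsub : smallPrimePows ⊆ Ioc 0 49 := by decide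
  refine le_trans ?_ (sum_le_sum_of_subset_of_nonneg hsub fun q hq _ => ?_)
  · have t (p k a b : ℕ) (hp : p.Prime) (hk : k ≠ 0) (ha : 0 < a) (hba : b ≤ a)
        (h : p ^ a ≤ 50 ^ b) := le_weight_mul_div n p k a b hp hk ha hba h
    have h2 := t 2 1 11 2 (by norm_num) (by norm_num) (by norm_num) (by norm_num) (by norm_num)
    have h4 := t 2 2 11 2 (by norm_num) (by norm_num) (by norm_num) (by norm_num) (by norm_num)
    have h8 := t 2 3 11 2 (by norm_num) (by norm_num) (by norm_num) (by norm_num) (by norm_num)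
    have h16 := t 2 4 11 2 (by norm_num) (by norm_num) (by norm_num) (by norm_num) (by norm_num)
    have h32 := t 2 5 11 2 (by norm_num) (by norm_num) (by norm_num) (by norm_num) (by norm_num)
    have h3 := t 3 1 7 2 (by norm_num) (by norm_num) (by norm_num) (by norm_num) (by norm_num)
    have h9 := t 3 2 7 2 (by norm_num) (by norm_num) (by norm_num) (by norm_num) (by norm_num)
    have h27 := t 3 3 7 2 (by norm_num) (by norm_num) (by norm_num) (by norm_num) (by norm_num)
    have h5 := t 5 1 7 3 (by norm_num) (by norm_num) (by norm_num) (by norm_num) (by norm_num)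
    have h25 := t 5 2 7 3 (by norm_num) (by norm_num) (by norm_num) (by norm_num) (by norm_num)
    have h7 := t 7 1 2 1 (by norm_num) (by norm_num) (by norm_num) (by norm_num) (by norm_num)
    have h49 := t 7 2 2 1 (by norm_num) (by norm_num) (by norm_num) (by norm_num) (by norm_num)
    have h11 := t 11 1 3 2 (by norm_num) (by norm_num) (by norm_num) (by norm_num) (by norm_num)
    have h13 := t 13 1 3 2 (by norm_num) (by norm_num) (by norm_num) (by norm_num) (by norm_num)
    have h17 := t 17 1 4 3 (by norm_num) (by norm_num) (by norm_num) (by norm_num) (by norm_num)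
    have h19 := t 19 1 5 4 (by norm_num) (by norm_num) (by norm_num) (by norm_num) (by norm_num)
    have h23 := t 23 1 6 5 (by norm_num) (by norm_num) (by norm_num) (by norm_num) (by norm_num)
    have h29 := t 29 1 1 1 (by norm_num) (by norm_num) (by norm_num) (by norm_num) (by norm_num)
    have h31 := t 31 1 1 1 (by norm_num) (by norm_num) (by norm_num) (by norm_num) (by norm_num)
    have h37 := t 37 1 1 1 (by norm_num) (by norm_num) (by norm_num) (by norm_num) (by norm_num)
    have h41 := t 41 1 1 1 (by norm_num) (by norm_num) (by norm_num) (by norm_num) (by norm_num)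
    have h43 := t 43 1 1 1 (by norm_num) (by norm_num) (by norm_num) (by norm_num) (by norm_num)
    have h47 := t 47 1 1 1 (by norm_num) (by norm_num) (by norm_num) (by norm_num) (by norm_num)
    clear t
    simp only [Nat.reducePow, Nat.cast_ofNat, Nat.cast_one] at *
    rw [show smallPrimePows = {2, 3, 4, 5, 7, 8, 9, 11, 13, 16, 17, 19, 23, 25, 27, 29, 31, 32, 37,
      41, 43, 47, 49} from rfl]
    repeat rw [sum_insert (by decide)]
    rw [sum_singleton]
    linarith
  · refine mul_nonneg ?_ (Nat.cast_nonneg _)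
    obtain ⟨hq0, hq49⟩ := mem_Ioc.1 hq
    have hq0' : (0 : ℝ) < q := by exact_mod_cast hq0
    have h1 : Real.log q ≤ Real.log 50 :=
      Real.log_le_log hq0' (by exact_mod_cast (by lia : q ≤ 50))
    rw [sub_nonneg, div_le_iff₀ hL, mul_comm]
    exact (vonMangoldt_le_log_mul_primePowIndicator q).trans (by gcongr)

/-! ### The bound for `n ≥ 50` -/

theorem le_log_fifty : (39 / 10 : ℝ) ≤ Real.log 50 := by
  have h : Real.exp 39 ≤ (50 : ℝ) ^ 10 := by
    have : Real.exp 39 = Real.exp 1 ^ 39 := by rw [← Real.exp_nat_mul]; norm_num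
    rw [this]
    calc Real.exp 1 ^ 39 ≤ (2.7182818286 : ℝ) ^ 39 := by
          gcongr
          exact Real.exp_one_lt_d9.le
      _ ≤ _ := by norm_num
  have := (Real.le_log_iff_exp_le (by positivity)).2 h
  rw [Real.log_pow] at this
  push_cast at this
  linarith

theorem log_log_fifty_sub_le : Real.log (Real.log 50) - Real.log (Real.log 7) ≤ 0.7182 := by
  have h7 : 0 < Real.log 7 := Real.log_pos (by norm_num)
  have h50 : 0 < Real.log 50 := Real.log_pos (by norm_num)
  have h1 : Real.log 50 / Real.log 7 ≤ 2 * (41 / 40) := by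
    have : Real.log ((50 : ℝ) ^ 20) ≤ Real.log (7 ^ 41) :=
      Real.log_le_log (by positivity) (by norm_num)
    rw [Real.log_pow, Real.log_pow] at this
    push_cast at this
    rw [div_le_iff₀ h7]
    linarith
  rw [← Real.log_div h50.ne' h7.ne']
  have h2 := Real.log_le_log (by positivity) h1
  rw [Real.log_mul (by norm_num) (by norm_num)] at h2
  have h3 := Real.log_le_sub_one_of_pos (x := 41 / 40) (by norm_num)
  linarith [Real.log_two_lt_d9]

theorem lt_omegaAverageDiff_of_fifty_le {n : ℕ} (hn : 50 ≤ n) :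
    8 / 7 - Real.log (Real.log 7) < omegaAverageDiff n := by
  have hn' : (50 : ℝ) ≤ n := by exact_mod_cast hn
  have hn0 : (0 : ℝ) < n := by linarith
  have hL1 := le_log_fifty
  have hLL := log_log_fifty_sub_le
  have hln : 0 < Real.log n := Real.log_pos (by linarith)
  have hparts := le_sum_vonMangoldt_div_log (n := n) (m := 49) (K := n) (by norm_num) hn le_rfl
  have hsmall := le_sum_small n
  rw [← log_factorial_eq_sum_vonMangoldt] at hparts
  have hfac : n - n / Real.log n ≤ Real.log n.factorial / Real.log n := by
    have := mul_log_sub_add_half_log_le_log_factorial (k := n) (by lia)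
    rw [le_div_iff₀ hln, sub_mul, div_mul_cancel₀ _ hln.ne']
    linarith
  have htail : ∑ q ∈ Ioc 49 n, vonMangoldt q * ((n / q : ℕ) : ℝ) / Real.log q
      ≤ ∑ q ∈ Ioc 49 n, (primePowIndicator q : ℝ) * ((n / q : ℕ) : ℝ) := by
    refine sum_le_sum fun q hq => ?_
    have hq' : 1 < (q : ℝ) := by exact_mod_cast (by have := (mem_Ioc.1 hq).1; lia : 1 < q)
    rw [mul_div_right_comm]
    refine mul_le_mul_of_nonneg_right ?_ (Nat.cast_nonneg _)
    rw [div_le_iff₀ (Real.log_pos hq'), mul_comm]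
    exact vonMangoldt_le_log_mul_primePowIndicator q
  have hsplit : (∑ k ∈ Icc 1 n, (cardFactors k : ℝ))
      = ∑ q ∈ Ioc 0 49, (primePowIndicator q : ℝ) * ((n / q : ℕ) : ℝ)
        + ∑ q ∈ Ioc 49 n, (primePowIndicator q : ℝ) * ((n / q : ℕ) : ℝ) := by
    rw [sum_Ioc_consecutive _ (by norm_num) (by lia)]
    exact_mod_cast sum_cardFactors_eq n
  have hsmall' : ∑ q ∈ Ioc 0 49, (primePowIndicator q - vonMangoldt q / Real.log 50)
        * ((n / q : ℕ) : ℝ)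
      = ∑ q ∈ Ioc 0 49, (primePowIndicator q : ℝ) * ((n / q : ℕ) : ℝ)
        - (∑ q ∈ Ioc 0 49, vonMangoldt q * ((n / q : ℕ) : ℝ)) / Real.log 50 := by
    rw [sum_div, ← sum_sub_distrib]
    exact sum_congr rfl fun q _ => by ring
  rw [hsmall'] at hsmall
  unfold primitive at hparts
  norm_num only [Nat.cast_ofNat] at hparts
  unfold omegaAverageDiff
  rw [lt_sub_iff_add_lt, one_div, ← div_eq_inv_mul, lt_div_iff₀ hn0, hsplit]
  set L := Real.log 50
  -- The bound `2 / L` for the coefficient of `n` costs little, and the constant `50 / L` it leaves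
  -- outweighs the rounding errors in `hsmall`.
  have e1 : ((n : ℝ) - 50) / L + n * (1 / L) ≤ (2 * n - 50) / (39 / 10) := by
    calc ((n : ℝ) - 50) / L + n * (1 / L) = (2 * n - 50) / L := by ring
      _ ≤ _ := by
        have : (0 : ℝ) ≤ 2 * n - 50 := by linarith
        gcongr
  have e2 : n * (Real.log L - Real.log (Real.log 7)) ≤ n * 0.7182 := by gcongr
  rw [sub_add_eq_add_sub, sub_mul, add_mul]
  have e3 : (n : ℝ) * (Real.log (Real.log n) + 1 / Real.log n - (Real.log L + 1 / L))
      = Real.log (Real.log n) * n + n / Real.log n - n * Real.log L - n * (1 / L) := by ring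
  linarith

/-! ### The bound for `n < 50` -/

/-- If `n ^ u < 7 ^ v` and `v / u ≤ (1 + x / 2) ^ 2` for some `x ≥ -2`, then
`log log n - log log 7 < x`; the integer form below has `x = S / n - 8 / 7`. -/
theorem log_log_sub_lt {n S u v : ℕ} (hn : 2 ≤ n) (hu : 0 < u) (h : n ^ u < 7 ^ v)
    (hv : v * (14 * n) ^ 2 ≤ u * (6 * n + 7 * S) ^ 2) :
    Real.log (Real.log n) - Real.log (Real.log 7) < (S : ℝ) / n - 8 / 7 := by
  have hn' : (2 : ℝ) ≤ n := by exact_mod_cast hn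
  have hu' : (0 : ℝ) < u := by exact_mod_cast hu
  have h7 : 0 < Real.log 7 := Real.log_pos (by norm_num)
  have hln : 0 < Real.log n := Real.log_pos (by linarith)
  have h1 : Real.log n / Real.log 7 < v / u := by
    rw [div_lt_div_iff₀ h7 hu', mul_comm, ← Real.log_pow, ← Real.log_pow]
    exact Real.log_lt_log (by positivity) (by exact_mod_cast h)
  set x : ℝ := (S : ℝ) / n - 8 / 7 with hx
  have hx1 : 1 + x / 2 = (6 * n + 7 * S) / (14 * n) := by
    rw [hx]
    field_simp
    ring
  have h2 : (v : ℝ) / u ≤ (1 + x / 2) ^ 2 := by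
    rw [hx1, div_pow, div_le_div_iff₀ hu' (by positivity), mul_comm _ (u : ℝ)]
    exact_mod_cast hv
  have h3 : (1 + x / 2) ^ 2 ≤ Real.exp x := by
    have e : Real.exp x = Real.exp (x / 2) ^ 2 := by
      rw [← Real.exp_nat_mul]
      congr 1
      push_cast
      ring
    have : 0 ≤ 1 + x / 2 := by rw [hx1]; positivity
    rw [e]
    gcongr
    linarith [Real.add_one_le_exp (x / 2)]
  rw [← Real.log_div hln.ne' h7.ne', Real.log_lt_iff_lt_exp (by positivity)]
  linarith

/-- The exponent `14` is fine enough for every `n`; the tightest cases are `n = 3` and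
`n = 5`, where `v = 8` and `v = 12`. -/
theorem exists_pow_lt_of_lt_fifty : ∀ n ∈ Ico 2 50, n ≠ 7 → ∃ v ∈ range 30,
    n ^ 14 < 7 ^ v ∧
      v * (14 * n) ^ 2 ≤ 14 * (6 * n + 7 * ∑ q ∈ smallPrimePows, n / q) ^ 2 := by
  decide +kernel

theorem lt_omegaAverageDiff_of_lt_fifty {n : ℕ} (h2 : 2 ≤ n) (h50 : n < 50) (h7 : n ≠ 7) :
    8 / 7 - Real.log (Real.log 7) < omegaAverageDiff n := by
  obtain ⟨v, -, h, hv⟩ := exists_pow_lt_of_lt_fifty n (mem_Ico.2 ⟨h2, h50⟩) h7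
  have key := log_log_sub_lt h2 (by norm_num) h hv
  have hS : ((∑ q ∈ smallPrimePows, n / q : ℕ) : ℝ) ≤ ∑ k ∈ Icc 1 n, (cardFactors k : ℝ) := by
    exact_mod_cast sum_smallPrimePows_le n
  have hS' := div_le_div_of_nonneg_right hS (Nat.cast_nonneg (α := ℝ) n)
  unfold omegaAverageDiff
  rw [one_div, ← div_eq_inv_mul]
  linarith

theorem omegaAverageDiff_seven : omegaAverageDiff 7 = 8 / 7 - Real.log (Real.log 7) := by
  have h : ∑ k ∈ Icc 1 7, cardFactors k = 8 := by
    have h4 : cardFactors 4 = 2 := cardFactors_apply_prime_pow (p := 2) (k := 2) (by norm_num)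
    have h6 : cardFactors 6 = 2 := by
      rw [show 6 = 2 * 3 from rfl, cardFactors_mul (by norm_num) (by norm_num),
        cardFactors_apply_prime (by norm_num), cardFactors_apply_prime (by norm_num)]
    rw [show Icc 1 7 = {1, 2, 3, 4, 5, 6, 7} from rfl]
    repeat rw [sum_insert (by decide)]
    rw [sum_singleton, cardFactors_one, cardFactors_apply_prime (p := 2) (by norm_num),
      cardFactors_apply_prime (p := 3) (by norm_num), h4,
      cardFactors_apply_prime (p := 5) (by norm_num), h6,
      cardFactors_apply_prime (p := 7) (by norm_num)]
    norm_num
  have h' : ∑ k ∈ Icc 1 7, (cardFactors k : ℝ) = 8 := by exact_mod_cast h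
  unfold omegaAverageDiff
  rw [h']
  norm_num

theorem lt_omegaAverageDiff {n : ℕ} (h2 : 2 ≤ n) (h7 : n ≠ 7) :
    8 / 7 - Real.log (Real.log 7) < omegaAverageDiff n := by
  rcases lt_or_ge n 50 with h | h
  · exact lt_omegaAverageDiff_of_lt_fifty h2 h h7
  · exact lt_omegaAverageDiff_of_fifty_le h

theorem mainTheorem2 :
    (∀ n : ℕ, 2 ≤ n → 8 / 7 - Real.log (Real.log 7) ≤ omegaAverageDiff n) ∧
    IsGreatest {c : ℝ | ∀ n : ℕ, 2 ≤ n → c ≤ omegaAverageDiff n}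
      (8 / 7 - Real.log (Real.log 7)) ∧
    (∀ n : ℕ, 2 ≤ n →
      (omegaAverageDiff n = 8 / 7 - Real.log (Real.log 7) ↔ n = 7)) := by
  have bound (n : ℕ) (hn : 2 ≤ n) : 8 / 7 - Real.log (Real.log 7) ≤ omegaAverageDiff n := by
    rcases eq_or_ne n 7 with rfl | h7
    · exact omegaAverageDiff_seven.ge
    · exact (lt_omegaAverageDiff hn h7).le
  refine ⟨bound, ⟨bound, fun c hc => ?_⟩, fun n hn => ⟨fun h => ?_, ?_⟩⟩
  · rw [← omegaAverageDiff_seven]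
    exact hc 7 (by norm_num)
  · by_contra h7
    exact (lt_omegaAverageDiff hn h7).ne' h
  · rintro rfl
    exact omegaAverageDiff_seven
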